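/- Let $L$ be a finite geometric lattice, that is, a finite lattice (with least element $0$) in which every non-zero element is a join of atoms (elements covering $0$) and which is semimodular: for all $a,b\in L$, if $a$ covers $a\wedge b$ then $a\vee b$ covers $b$. For $a\in L$ let the rank $r(a)$ be the maximum length of a chain of $L$ with greatest element $a$, where a chain with $k+1$ elements has length $k$. Let $\mu_L$ be the Möbius function of $L$, that is, the inverse of the zeta function in the incidence algebra of $L$: $\mu_L(a,a)=1$, $\mu_L(a,b)=-\sum_{a\le x<b}\mu_L(a,x)$ if $a<b$, and $\mu_L(a,b)=0$ if $a\not\le b$. Then for all $a,b\in L$ with $a\le b$, $$(-1)^{r(b)-r(a)}\,\mu_L(a,b)>0 .$$ In particular $\mu_L(a,b)\neq 0$, and its sign is $(-1)^{r(b)-r(a)}$. -/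

import Mathlib

/-- A lattice with zero is geometric if it is a semimodular point-lattice: every element is the
join of a set of atoms (the zero element being the empty join), and `b ⋖ a ⊔ b` whenever
`a ⊓ b ⋖ a`. -/
class IsGeometricLattice (L : Type*) [Lattice L] [OrderBot L] : Prop extends
    IsAtomistic L, IsUpperModularLattice L

/-- The rank of an element: the maximum length (number of steps) of a chain ending at it.
`Order.height` is the supremum of these lengths in `ℕ∞`; it is finite in a finite order. -/
noncomputable def latticeRank {L : Type*} [Preorder L] (a : L) : ℕ :=
  (Order.height a).toNat

/-- In a finite order the rank is monotone, so `latticeRank b - latticeRank a` is not truncated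
when `a ≤ b`. -/
theorem latticeRank_mono {L : Type*} [PartialOrder L] [Finite L] {a b : L} (h : a ≤ b) :
    latticeRank a ≤ latticeRank b := by
  have := Fintype.ofFinite L
  have hb : Order.height b ≤ (Fintype.card L : ℕ∞) :=
    Order.height_le fun p _ => by exact_mod_cast p.length_lt_card.le
  exact ENat.toNat_le_toNat (Order.height_mono h) (ne_top_of_le_ne_top (ENat.natCast_ne_top _) hb)

/-!
Let `a ⋖ c ≤ b`. Weisner's identity expresses `μ(a, b)` as `-∑ μ(a, x)` over the `x ∈ [a, b)` with
`x ⊔ c = b`. Semimodularity forces each such `x` to be covered by `b`, hence to have rank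
`r(b) - 1`, so by induction all the terms `μ(a, x)` have the same sign `(-1) ^ (r(b) - 1 - r(a))`;
and the sum is not empty because `c` has a relative complement in `[a, b]`.

That covers raise the rank by exactly one is the Jordan–Dedekind property. In an upper semimodular
lattice the coheight drops by one along covers, as two distinct covers of an element have a common
cover. Below a fixed `b` the height and the coheight therefore add up to the height of `b`.
-/

open Finset IncidenceAlgebra

section JordanDedekind

open Order

variable {α : Type*} [Lattice α] [IsWeakUpperModularLattice α]

theorem covBy_sup_and_covBy_sup_of_covBy_of_ne {a b c : α} (hab : a ⋖ b) (hac : a ⋖ c)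
    (hbc : b ≠ c) : b ⋖ b ⊔ c ∧ c ⋖ b ⊔ c := by
  obtain rfl : b ⊓ c = a := hab.wcovBy.inf_eq hac.wcovBy hbc
  exact ⟨covBy_sup_of_inf_covBy_of_inf_covBy_left hab hac,
    covBy_sup_of_inf_covBy_of_inf_covBy_right hab hac⟩

theorem coheight_eq_of_covBy_of_coheight_eq_coe [IsStronglyAtomic α] {a b : α} (hab : a ⋖ b)
    {n : ℕ} (hb : coheight b = n) : coheight a = n + 1 := by
  induction n using Nat.strong_induction_on generalizing a b with
  | _ n ih =>
    refine le_antisymm ?_ (hb ▸ coheight_add_one_le hab.lt)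
    suffices ∀ c, a ⋖ c → coheight c = n by
      refine mod_cast coheight_le_coe_iff.2 fun y hay => ?_
      obtain ⟨c, hac, hcy⟩ := exists_covBy_le_of_lt hay
      exact (coheight_anti hcy).trans_lt (this c hac ▸ mod_cast n.lt_succ_self)
    intro c hac
    obtain rfl | hbc := eq_or_ne b c
    · exact hb
    obtain ⟨hb_sup, hc_sup⟩ := covBy_sup_and_covBy_sup_of_covBy_of_ne hab hac hbc
    have h_lt : coheight (b ⊔ c) < n := coheight_le_coe_iff.1 hb.le _ hb_sup.lt
    obtain ⟨m, hm⟩ := ENat.ne_top_iff_exists.1 h_lt.ne_top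
    have hmn : m < n := Nat.cast_lt.1 (hm ▸ h_lt)
    rw [ih m hmn hc_sup hm.symm, ← ih m hmn hb_sup hm.symm, hb]

theorem coheight_eq_add_one_of_covBy [IsStronglyAtomic α] {a b : α} (hab : a ⋖ b) :
    coheight a = coheight b + 1 := by
  cases hb : coheight b with
  | top => exact top_le_iff.1 (hb ▸ coheight_anti hab.le)
  | coe n => exact coheight_eq_of_covBy_of_coheight_eq_coe hab hb

theorem exists_covBy_height_eq_coe {β : Type*} [PartialOrder β] {b : β} {n : ℕ}
    (hb : height b = n + 1) : ∃ a, a ⋖ b ∧ height a = n := by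
  obtain ⟨-, ⟨a, hab, ha⟩, hle⟩ := height_eq_coe_add_one_iff.1 hb
  refine ⟨a, ⟨hab, fun x hax hxb => ?_⟩, ha⟩
  exact ((height_strictMono hax (ha ▸ ENat.natCast_lt_top n)).trans_le (hle x hxb)).ne ha

theorem height_add_coheight_eq_coheight_bot [OrderBot α] [IsStronglyAtomic α] {a : α}
    (ha : height a ≠ ⊤) : height a + coheight a = coheight (⊥ : α) := by
  obtain ⟨n, hn⟩ := ENat.ne_top_iff_exists.1 ha
  clear ha
  induction n generalizing a with
  | zero =>
    obtain rfl : a = ⊥ := isMin_iff_eq_bot.1 (height_eq_zero.1 hn.symm)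
    simp
  | succ n ih =>
    obtain ⟨x, hxa, hx⟩ := exists_covBy_height_eq_coe (by exact_mod_cast hn.symm)
    rw [← ih hx.symm, coheight_eq_add_one_of_covBy hxa, hx, ← hn, Nat.cast_add_one,
      add_assoc, add_comm 1]

theorem height_coe_of_isLowerSet {β : Type*} [Preorder β] {s : Set β} (hs : IsLowerSet s) (x : s) :
    height (x : β) = height x :=
  (height_eq_of_strictMono _ (Subtype.strictMono_coe (· ∈ s))
    (fun a y hya => ⟨⟨y, hs hya.le a.2⟩, hya, rfl⟩) x).symm

theorem covBy_coe_iff_of_ordConnected {β : Type*} [Preorder β] {s : Set β} [s.OrdConnected]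
    {x y : s} : (x : β) ⋖ y ↔ x ⋖ y :=
  Set.OrdConnected.apply_covBy_apply_iff (OrderEmbedding.subtype (· ∈ s))
    (Subtype.range_coe.symm ▸ ‹s.OrdConnected›)

instance isWeakUpperModularLattice_Iic {b : α} : IsWeakUpperModularLattice (Set.Iic b) where
  covBy_sup_of_inf_covBy_covBy h₁ h₂ :=
    covBy_coe_iff_of_ordConnected.1 <| covBy_sup_of_inf_covBy_of_inf_covBy_left
      (covBy_coe_iff_of_ordConnected.2 h₁) (covBy_coe_iff_of_ordConnected.2 h₂)

theorem height_eq_add_one_of_covBy [OrderBot α] [IsStronglyAtomic α] {a b : α} (hab : a ⋖ b) :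
    height b = height a + 1 := by
  by_cases ha : height a = ⊤
  · rw [ha, top_add]
    exact top_le_iff.1 (ha ▸ height_mono hab.le)
  let a' : Set.Iic b := ⟨a, hab.le⟩
  have h_coe (x : Set.Iic b) : height (x : α) = height x :=
    height_coe_of_isLowerSet (isLowerSet_Iic b) x
  have ha' : height a' ≠ ⊤ := h_coe a' ▸ ha
  have ha'_top : a' ⋖ ⊤ := covBy_coe_iff_of_ordConnected.1 hab
  calc height b = height (⊤ : Set.Iic b) := h_coe ⊤
    _ = coheight (⊥ : Set.Iic b) :=
      WithBot.coe_injective (height_top_eq_krullDim.trans coheight_bot_eq_krullDim.symm)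
    _ = height a' + coheight a' := (height_add_coheight_eq_coheight_bot ha').symm
    _ = height a + 1 := by
      rw [coheight_eq_add_one_of_covBy ha'_top, coheight_top, zero_add, ← h_coe a']

end JordanDedekind

section LatticeRank

theorem height_ne_top_of_locallyFiniteOrder {α : Type*} [PartialOrder α] [OrderBot α]
    [LocallyFiniteOrder α] (a : α) : Order.height a ≠ ⊤ := by
  have := Fintype.ofFinite (Set.Iic a)
  rw [height_coe_of_isLowerSet (isLowerSet_Iic a) ⟨a, le_rfl⟩]
  exact ne_top_of_le_ne_top (ENat.natCast_ne_top _)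
    (Order.height_le fun p _ => mod_cast p.length_lt_card.le)

variable {α : Type*} [Lattice α] [OrderBot α] [LocallyFiniteOrder α] [IsWeakUpperModularLattice α]

theorem latticeRank_eq_add_one_of_covBy {a b : α} (hab : a ⋖ b) :
    latticeRank b = latticeRank a + 1 := by
  rw [latticeRank, height_eq_add_one_of_covBy hab,
    ENat.toNat_add (height_ne_top_of_locallyFiniteOrder a) ENat.one_ne_top, ENat.toNat_one,
    latticeRank]

theorem latticeRank_sub_eq_add_one_of_covBy {a x b : α} (hax : a ≤ x) (hxb : x ⋖ b) :
    latticeRank b - latticeRank a = latticeRank x - latticeRank a + 1 := by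
  have h_mono : latticeRank a ≤ latticeRank x :=
    ENat.toNat_le_toNat (Order.height_mono hax) (height_ne_top_of_locallyFiniteOrder x)
  rw [latticeRank_eq_add_one_of_covBy hxb, Nat.sub_add_comm h_mono]

end LatticeRank

theorem le_strong_induction {α : Type*} [Preorder α] [LocallyFiniteOrder α] {a : α}
    {P : ∀ b, a ≤ b → Prop}
    (step : ∀ b (hab : a ≤ b), (∀ x (hax : a ≤ x), x < b → P x hax) → P b hab) (b : α)
    (hab : a ≤ b) : P b hab := by
  induction hs : Icc a b using Finset.strongInduction generalizing b with
  | H s ih =>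
    subst hs
    exact step b hab fun x hax hxb => ih _ (Icc_ssubset_Icc_right hab le_rfl hxb) x hax rfl

section Weisner

variable {𝕜 α : Type*} [AddCommGroup 𝕜] [One 𝕜] [SemilatticeSup α] [LocallyFiniteOrder α]
  [DecidableEq α] {a b c : α}

theorem sum_mu_filter_sup_eq_zero (hac : a < c) (hcb : c ≤ b) :
    ∑ x ∈ Icc a b with x ⊔ c = b, mu 𝕜 a x = 0 := by
  induction b, hcb using le_strong_induction with | step b hcb ih
  have h_maps : ∀ x ∈ Icc a b, x ⊔ c ∈ Icc c b := fun x hx =>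
    mem_Icc.2 ⟨le_sup_right, sup_le (mem_Icc.1 hx).2 hcb⟩
  have h_fiber : ∀ z ∈ Icc c b, z ≠ b → ∑ x ∈ Icc a b with x ⊔ c = z, mu 𝕜 a x = 0 := by
    intro z hz hzb
    obtain ⟨hcz, hz_le⟩ := mem_Icc.1 hz
    rw [← ih z hcz (hz_le.lt_of_ne hzb)]
    refine sum_congr (Finset.ext fun x => ?_) fun _ _ => rfl
    simp only [mem_filter, mem_Icc]
    refine ⟨fun ⟨⟨hax, _⟩, hxz⟩ => ⟨⟨hax, hxz ▸ le_sup_left⟩, hxz⟩,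
      fun ⟨⟨hax, hxz⟩, h_sup⟩ => ⟨⟨hax, hxz.trans hz_le⟩, h_sup⟩⟩
  calc ∑ x ∈ Icc a b with x ⊔ c = b, mu 𝕜 a x
      = ∑ z ∈ Icc c b, ∑ x ∈ Icc a b with x ⊔ c = z, mu 𝕜 a x :=
        (sum_eq_single_of_mem b (right_mem_Icc.2 hcb) h_fiber).symm
    _ = ∑ x ∈ Icc a b, mu 𝕜 a x := sum_fiberwise_of_maps_to h_maps _
    _ = 0 := by rw [sum_Icc_mu_right, if_neg (hac.trans_le hcb).ne]

theorem mu_eq_neg_sum_Ico_filter_sup_eq (hac : a < c) (hcb : c ≤ b) :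
    mu 𝕜 a b = -∑ x ∈ Ico a b with x ⊔ c = b, mu 𝕜 a x := by
  have h_sum := sum_mu_filter_sup_eq_zero (𝕜 := 𝕜) hac hcb
  rw [← Ico_insert_right (hac.le.trans hcb), filter_insert, if_pos (sup_eq_left.2 hcb),
    sum_insert (by simp)] at h_sum
  exact eq_neg_of_add_eq_zero_left h_sum

end Weisner

theorem covBy_of_covBy_of_sup_eq {α : Type*} [Lattice α] [IsUpperModularLattice α] {a b c x : α}
    (hac : a ⋖ c) (hax : a ≤ x) (hxb : x < b) (hxc : x ⊔ c = b) : x ⋖ b := by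
  have hcx : ¬ c ≤ x := fun h => hxb.ne (by rw [← hxc, sup_eq_left.2 h])
  have h_inf : c ⊓ x = a :=
    (hac.eq_or_eq (le_inf hac.le hax) inf_le_left).resolve_right fun h => hcx (inf_eq_left.1 h)
  rw [← hxc, sup_comm]
  exact covBy_sup_of_inf_covBy_left (h_inf ▸ hac)

section Geometric

variable {L : Type*} [Lattice L] [OrderBot L] [IsGeometricLattice L]

theorem covBy_sup_of_isAtom_of_not_le {p x : L} (hp : IsAtom p) (hpx : ¬ p ≤ x) : x ⋖ p ⊔ x :=
  covBy_sup_of_inf_covBy_left ((hp.not_le_iff_disjoint.1 hpx).eq_bot ▸ hp.bot_covBy)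

variable [LocallyFiniteOrder L]

theorem exists_mem_Ico_sup_eq {a b c : L} (hab : a ≤ b) (hca : ¬ c ≤ a) (hcb : c ≤ b) :
    ∃ x ∈ Ico a b, x ⊔ c = b := by
  obtain ⟨x, ⟨⟨hax, hxb⟩, hcx⟩, h_max⟩ :=
    ((Set.finite_Icc a b).subset (Set.sep_subset _ (¬ c ≤ ·))).exists_maximal
      ⟨a, ⟨le_rfl, hab⟩, hca⟩
  refine ⟨x, mem_Ico.2 ⟨hax, hxb.lt_of_ne fun h => hcx (h ▸ hcb)⟩,
    (sup_le hxb hcb).antisymm (le_iff_atom_le_imp.2 fun p hp hpb => ?_)⟩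
  by_cases hpx : p ≤ x
  · exact le_sup_of_le_left hpx
  have h_cov : x ⋖ p ⊔ x := covBy_sup_of_isAtom_of_not_le hp hpx
  have hc_le : c ≤ p ⊔ x := by
    by_contra hc
    exact h_cov.lt.not_ge (h_max ⟨⟨hax.trans h_cov.le, sup_le hpb hxb⟩, hc⟩ h_cov.le)
  have h_sup : x ⊔ c = p ⊔ x :=
    (h_cov.eq_or_eq le_sup_left (sup_le h_cov.le hc_le)).resolve_left (hcx <| sup_eq_left.1 ·)
  exact h_sup ▸ le_sup_left

theorem mainTheorem5_general {𝕜 : Type*} [Ring 𝕜] [PartialOrder 𝕜] [IsStrictOrderedRing 𝕜]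
    [DecidableEq L] (a b : L) (hab : a ≤ b) :
    0 < (-1 : 𝕜) ^ (latticeRank b - latticeRank a) * mu 𝕜 a b := by
  induction b, hab using le_strong_induction with | step b hab ih
  obtain rfl | hlt := hab.eq_or_lt
  · simp
  obtain ⟨c, hac, hcb⟩ := exists_covBy_le_of_lt hlt
  rw [mu_eq_neg_sum_Ico_filter_sup_eq hac.lt hcb, ← sum_neg_distrib, mul_sum]
  refine sum_pos (fun x hx => ?_) ?_
  · obtain ⟨hx_mem, hxc⟩ := mem_filter.1 hx
    obtain ⟨hax, hxb⟩ := mem_Ico.1 hx_mem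
    have hx_cov : x ⋖ b := covBy_of_covBy_of_sup_eq hac hax hxb hxc
    rw [latticeRank_sub_eq_add_one_of_covBy hax hx_cov, pow_succ, mul_neg_one, neg_mul_neg]
    exact ih x hax hxb
  · obtain ⟨x, hx, hxc⟩ := exists_mem_Ico_sup_eq hab hac.lt.not_ge hcb
    exact ⟨x, mem_filter.2 ⟨hx, hxc⟩⟩

end Geometric

theorem mainTheorem5 {L : Type*} [Lattice L] [OrderBot L] [Finite L] [LocallyFiniteOrder L]
    [DecidableEq L] [IsGeometricLattice L] (a b : L) (hab : a ≤ b) :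
    0 < (-1 : ℤ) ^ (latticeRank b - latticeRank a) * IncidenceAlgebra.mu ℤ a b :=
  mainTheorem5_general a b hab
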